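/- For a nonnegative sequence $(\omega_i)$ of numbers in $[0,1]$ put $\operatorname{entropy}(\omega)=-\sum_i \omega_i\ln\omega_i\in[0,\infty]$ (with $0\ln 0=0$). Let $S\subset\ell_1$ be the set of nonnegative real sequences with sum $1$. Let $\mathcal H$ be a separable complex Hilbert space, and let $O$ be the set of positive (semidefinite) trace class operators on $\mathcal H$ with trace $1$ (density operators); the entropy of $\omega\in O$ is the entropy of the sequence of its eigenvalues, counted with multiplicity. On trace class operators $\|A\|_1=\operatorname{tr}|A|$ and $\|A\|_\infty$ is the operator norm. (S) Let $T:\ell_1\to\ell_1$ be a linear map (real or complex sequences; real-linearity suffices) with $\|Tx\|_1\le\|x\|_1$ and $\|Tx\|_\infty\le\|x\|_\infty$ for all $x\in\ell_1$. If $\omega\in S$ and $T\omega\in S$, then $\operatorname{entropy}(\omega)\le\operatorname{entropy}(T\omega)$. (O) Let $T$ be a linear map (real-linearity suffices) of the space of trace class operators on $\mathcal H$ into itself with $\|TA\|_1\le\|A\|_1$ and $\|TA\|_\infty\le\|A\|_\infty$ for all trace class $A$. If $\omega\in O$ and $T\omega\in O$, then $\operatorname{entropy}(\omega)\le\operatorname{entropy}(T\omega)$.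 In particular, let $(b_i)$ be any orthonormal basis of $\mathcal H$ and let $\omega\in O$. Then there is exactly one bounded operator $D$ on $\mathcal H$ whose matrix in the basis $(b_i)$ is obtained from that of $\omega$ by erasing all off-diagonal entries, i.e. $\langle b_i,Db_i\rangle=\langle b_i,\omega b_i\rangle$ for all $i$ and $\langle b_i,Db_j\rangle=0$ for $i\ne j$; it belongs to $O$, and $\operatorname{entropy}(\omega)\le\operatorname{entropy}(D)$. -/

import Mathlib

open scoped ENNReal InnerProductSpace ComplexOrder

noncomputable section

namespace EntropyNote

/-! ### Probability sequences and their entropy -/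

section Sequences

variable (𝕜 : Type*) [RCLike 𝕜]

/-- The sequence space `ℓ₁` of absolutely summable (real or complex) sequences. -/
abbrev ell1 : Type _ := lp (fun _ : ℕ => 𝕜) 1

variable {𝕜}

/-- The supremum norm of a sequence, with value in `[0, ∞]`. -/
def supNorm (x : ℕ → 𝕜) : ℝ≥0∞ := ⨆ n, ‖x n‖ₑ

variable (𝕜) in
/-- The set of probability sequences in `ℓ₁`: nonnegative real sequences with sum `1`. -/
def probabilitySequences : Set (ell1 𝕜) :=
  {x | (∀ n, 0 ≤ x n) ∧ HasSum (fun n => x n) 1}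

/-- The entropy `-∑ᵢ ωᵢ ln ωᵢ` (with `0 ln 0 = 0`), with value in `[0, ∞]`. All terms are
nonnegative when the `ωᵢ` lie in `[0, 1]`, as is the case for a probability sequence. -/
def seqEntropy (ω : ℕ → ℝ) : ℝ≥0∞ := ∑' n, ENNReal.ofReal (Real.negMulLog (ω n))

end Sequences

/-! ### Trace class operators, density operators and their entropy -/

section Operators

variable (H : Type*) [NormedAddCommGroup H] [InnerProductSpace ℂ H] [CompleteSpace H]

/-- The index set of the Hilbert basis `someBasis H`. -/
def someBasisIndex : Set H := (exists_hilbertBasis ℂ H).choose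

/-- Some orthonormal basis of `H`, used to write down traces (which do not depend on it). -/
def someBasis : HilbertBasis (someBasisIndex H) ℂ H :=
  (exists_hilbertBasis ℂ H).choose_spec.choose

variable {H}

/-- The trace norm `‖A‖₁ = tr |A|`, with value in `[0, ∞]`; here `|A| = (A* A)^(1/2)`. -/
def traceNorm (A : H →L[ℂ] H) : ℝ≥0∞ :=
  ∑' i, ENNReal.ofReal (⟪someBasis H i, CFC.abs A (someBasis H i)⟫_ℂ).re

/-- `A` is of trace class. -/
def IsTraceClass (A : H →L[ℂ] H) : Prop := traceNorm A ≠ ∞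

/-- The trace of a (trace class) operator. -/
def trace (A : H →L[ℂ] H) : ℂ := ∑' i, ⟪someBasis H i, A (someBasis H i)⟫_ℂ

lemma traceNorm_zero : traceNorm (0 : H →L[ℂ] H) = 0 := by
  simp [traceNorm]

lemma traceNorm_smul (c : ℂ) (A : H →L[ℂ] H) : traceNorm (c • A) = ‖c‖ₑ * traceNorm A := by
  simp only [traceNorm, ← ENNReal.tsum_mul_left]
  refine tsum_congr fun i => ?_
  rw [CFC.abs_smul, ← ofReal_norm, ← ENNReal.ofReal_mul (norm_nonneg c)]
  congr 1
  rw [_root_.smul_apply, inner_smul_right_eq_smul]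
  simp

lemma norm_abs_apply (A : H →L[ℂ] H) (x : H) : ‖CFC.abs A x‖ = ‖A x‖ := by
  have h1 : (CFC.abs A).IsPositive :=
    (ContinuousLinearMap.nonneg_iff_isPositive _).1 (CFC.abs_nonneg A)
  have h2 : ⟪CFC.abs A x, CFC.abs A x⟫_ℂ = ⟪A x, A x⟫_ℂ := by
    rw [h1.inner_left_eq_inner_right, ← mul_apply_eq_comp, CFC.abs_mul_abs,
      mul_apply_eq_comp, ContinuousLinearMap.star_eq_adjoint,
      ContinuousLinearMap.adjoint_inner_right]
  rw [inner_self_eq_norm_sq_to_K, inner_self_eq_norm_sq_to_K] at h2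
  have h3 : ‖CFC.abs A x‖ ^ 2 = ‖A x‖ ^ 2 := by exact_mod_cast h2
  exact (sq_eq_sq₀ (norm_nonneg _) (norm_nonneg _)).1 h3

/-- Factorization through a contraction; it yields the polar decomposition. -/
lemma exists_contraction_comp_eq (B C : H →L[ℂ] H) (h : ∀ x, ‖B x‖ ≤ ‖C x‖) :
    ∃ U : H →L[ℂ] H, ‖U‖ ≤ 1 ∧ ∀ x, U (C x) = B x := by
  let K : Submodule ℂ H := (LinearMap.range (C : H →ₗ[ℂ] H)).topologicalClosure
  have : CompleteSpace K := (Submodule.isClosed_topologicalClosure _).completeSpace_coe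
  have hm : ∀ x, C x ∈ K := fun x => Submodule.le_topologicalClosure _ ⟨x, rfl⟩
  let e : H →ₗ[ℂ] K := (C : H →ₗ[ℂ] H).codRestrict K hm
  have hd : DenseRange e := by
    intro y
    rw [closure_subtype]
    have hy : (y : H) ∈ closure (LinearMap.range (C : H →ₗ[ℂ] H) : Set H) := y.2
    refine closure_mono ?_ hy
    rintro _ ⟨x, rfl⟩
    exact ⟨e x, ⟨x, rfl⟩, rfl⟩
  have hn : ∀ x, ‖(B : H →ₗ[ℂ] H) x‖ ≤ 1 * ‖e x‖ := fun x => by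
    rw [one_mul]; exact h x
  refine ⟨((B : H →ₗ[ℂ] H).extendOfNorm e).comp K.orthogonalProjectionOnto, ?_, fun x => ?_⟩
  · refine (ContinuousLinearMap.opNorm_comp_le _ _).trans ?_
    exact mul_le_one₀ (LinearMap.opNorm_extendOfNorm_le hd zero_le_one hn) (norm_nonneg _)
      K.orthogonalProjectionOnto_norm_le
  · have : K.orthogonalProjectionOnto (C x) = e x :=
      Submodule.orthogonalProjectionOnto_mem_subspace_eq_self (⟨C x, hm x⟩ : K)
    rw [ContinuousLinearMap.comp_apply, this, LinearMap.extendOfNorm_eq hd ⟨1, hn⟩]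
    rfl

lemma tsum_enorm_inner_sq {ι : Type*} (b : HilbertBasis ι ℂ H) (x : H) :
    ∑' i, ‖⟪b i, x⟫_ℂ‖ₑ ^ 2 = ‖x‖ₑ ^ 2 := by
  have h := b.hasSum_inner_mul_inner x x
  have h' : HasSum (fun i => ‖⟪b i, x⟫_ℂ‖ ^ 2) (‖x‖ ^ 2) := by
    rw [← Complex.hasSum_ofReal]
    rw [inner_self_eq_norm_sq_to_K] at h
    convert! h using 1
    · ext i
      rw [← inner_conj_symm x (b i), Complex.conj_mul']
      simp
    · simp
  simp only [← ofReal_norm, ← ENNReal.ofReal_pow (norm_nonneg _)]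
  rw [← ENNReal.ofReal_tsum_of_nonneg (fun i => by positivity) h'.summable, h'.tsum_eq]

lemma tsum_enorm_adjoint_sq {ι κ : Type*} (b : HilbertBasis ι ℂ H) (c : HilbertBasis κ ℂ H)
    (A : H →L[ℂ] H) : ∑' i, ‖A (b i)‖ₑ ^ 2 = ∑' j, ‖ContinuousLinearMap.adjoint A (c j)‖ₑ ^ 2 := by
  simp only [← tsum_enorm_inner_sq c (A _), ← tsum_enorm_inner_sq b (ContinuousLinearMap.adjoint A _)]
  rw [ENNReal.tsum_comm]
  refine tsum_congr fun j => tsum_congr fun i => ?_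
  rw [ContinuousLinearMap.adjoint_inner_right, ← ofReal_norm, ← ofReal_norm, norm_inner_symm]

lemma tsum_enorm_comp_sq_le {ι : Type*} (b : HilbertBasis ι ℂ H) (S X : H →L[ℂ] H) (hX : ‖X‖ ≤ 1)
    (hS : S.IsPositive) : ∑' i, ‖S (X (b i))‖ₑ ^ 2 ≤ ∑' i, ‖S (b i)‖ₑ ^ 2 := by
  have h := tsum_enorm_adjoint_sq b b (S.comp X)
  simp only [ContinuousLinearMap.comp_apply, ContinuousLinearMap.adjoint_comp] at h
  rw [h, hS.isSelfAdjoint.adjoint_eq]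
  refine ENNReal.tsum_le_tsum fun i => ?_
  gcongr
  rw [← ofReal_norm, ← ofReal_norm]
  apply ENNReal.ofReal_le_ofReal
  refine (ContinuousLinearMap.le_opNorm _ _).trans (mul_le_of_le_one_left (norm_nonneg _) ?_)
  rwa [LinearIsometryEquiv.norm_map]

/-- `∑ᵢ |⟨X bᵢ, A bᵢ⟩| ≤ ‖A‖₁` for every contraction `X`. -/
lemma tsum_enorm_inner_le_traceNorm (A X : H →L[ℂ] H) (hX : ‖X‖ ≤ 1) :
    ∑' i, ‖⟪X (someBasis H i), A (someBasis H i)⟫_ℂ‖ₑ ≤ traceNorm A := by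
  set b := someBasis H
  obtain ⟨U, hU, hUA⟩ := exists_contraction_comp_eq A (CFC.abs A)
    (fun x => (norm_abs_apply A x).ge)
  let S : H →L[ℂ] H := CFC.sqrt (CFC.abs A)
  have hS : S.IsPositive :=
    (ContinuousLinearMap.nonneg_iff_isPositive _).1 (CFC.sqrt_nonneg _)
  have hSS : ∀ x, S (S x) = CFC.abs A x := fun x => by
    rw [← mul_apply_eq_comp, CFC.sqrt_mul_sqrt_self _ (CFC.abs_nonneg A)]
  have htr : traceNorm A = ∑' i, ‖S (b i)‖ₑ ^ 2 := by
    refine tsum_congr fun i => ?_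
    rw [← hSS, ← hS.inner_left_eq_inner_right, inner_self_eq_norm_sq_to_K, ← ofReal_norm,
      ← ENNReal.ofReal_pow (norm_nonneg _)]
    congr 1
    norm_cast
  let W : H →L[ℂ] H := (ContinuousLinearMap.adjoint U).comp X
  have hW : ‖W‖ ≤ 1 := by
    refine (ContinuousLinearMap.opNorm_comp_le _ _).trans (mul_le_one₀ ?_ (norm_nonneg _) hX)
    rwa [LinearIsometryEquiv.norm_map]
  have hW' := tsum_enorm_comp_sq_le b S W hW hS
  have key : ∀ i, 2 * ‖⟪X (b i), A (b i)⟫_ℂ‖ₑ ≤ ‖S (W (b i))‖ₑ ^ 2 + ‖S (b i)‖ₑ ^ 2 := fun i => by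
    have h1 : ⟪X (b i), A (b i)⟫_ℂ = ⟪S (W (b i)), S (b i)⟫_ℂ := by
      rw [hS.inner_left_eq_inner_right, hSS, ContinuousLinearMap.comp_apply,
        ContinuousLinearMap.adjoint_inner_left, hUA]
    rw [h1]
    simp only [← ofReal_norm, ← ENNReal.ofReal_pow (norm_nonneg _)]
    rw [← ENNReal.ofReal_add (by positivity) (by positivity),
      show (2 : ℝ≥0∞) = ENNReal.ofReal 2 by simp, ← ENNReal.ofReal_mul (by norm_num)]
    apply ENNReal.ofReal_le_ofReal
    have := norm_inner_le_norm (𝕜 := ℂ) (S (W (b i))) (S (b i))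
    nlinarith [sq_nonneg (‖S (W (b i))‖ - ‖S (b i)‖)]
  have h2 : 2 * ∑' i, ‖⟪X (b i), A (b i)⟫_ℂ‖ₑ ≤ 2 * traceNorm A := by
    rw [← ENNReal.tsum_mul_left]
    refine (ENNReal.tsum_le_tsum key).trans ?_
    rw [ENNReal.tsum_add, two_mul, htr]
    gcongr
  exact (ENNReal.mul_le_mul_iff_right (by norm_num) (by norm_num)).1 h2

lemma traceNorm_add_le (A B : H →L[ℂ] H) : traceNorm (A + B) ≤ traceNorm A + traceNorm B := by
  obtain ⟨V, hV, hVA⟩ := exists_contraction_comp_eq (CFC.abs (A + B)) (A + B)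
    (fun x => (norm_abs_apply _ x).le)
  have hV' : ‖ContinuousLinearMap.adjoint V‖ ≤ 1 := by rwa [LinearIsometryEquiv.norm_map]
  refine le_trans ?_ (add_le_add (tsum_enorm_inner_le_traceNorm A _ hV')
    (tsum_enorm_inner_le_traceNorm B _ hV'))
  rw [← ENNReal.tsum_add]
  refine ENNReal.tsum_le_tsum fun i => ?_
  rw [← hVA, ← ContinuousLinearMap.adjoint_inner_left, _root_.add_apply,
    inner_add_right]
  refine le_trans ?_ (enorm_add_le _ _)
  rw [← ofReal_norm]
  exact ENNReal.ofReal_le_ofReal (Complex.re_le_norm _)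

variable (H) in
/-- The space of trace class operators on `H`, as a subspace of `B(H)`. -/
def traceClass : Submodule ℂ (H →L[ℂ] H) where
  carrier := {A | IsTraceClass A}
  zero_mem' := by simp [IsTraceClass, traceNorm_zero]
  add_mem' {A B} hA hB := ne_top_of_le_ne_top (ENNReal.add_ne_top.2 ⟨hA, hB⟩)
    (traceNorm_add_le A B)
  smul_mem' c A hA := by
    simpa [IsTraceClass, traceNorm_smul] using ENNReal.mul_ne_top enorm_ne_top hA

/-- Density operators: positive (semidefinite) trace class operators of trace `1`. -/
def IsDensityOperator (A : H →L[ℂ] H) : Prop :=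
  A.IsPositive ∧ IsTraceClass A ∧ trace A = 1

/-- The entropy `-∑ᵢ ωᵢ ln ωᵢ` of a density operator, where `(ωᵢ)` is the sequence of its
eigenvalues repeated according to multiplicity, with value in `[0, ∞]`. The sum runs over all real
numbers `μ`, each weighted by its multiplicity as an eigenvalue, which is `0` if `μ` is not one.
All nonzero eigenvalues of a density operator lie in `(0, 1]` and have finite multiplicity; the
eigenvalue `0` contributes nothing. -/
def operatorEntropy (A : H →L[ℂ] H) : ℝ≥0∞ :=
  ∑' μ : ℝ, (Module.finrank ℂ (Module.End.eigenspace (A : H →ₗ[ℂ] H) (μ : ℂ)) : ℝ≥0∞) *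
    ENNReal.ofReal (Real.negMulLog μ)

/-- The matrix of `D` in the orthonormal basis `b` arises from the matrix of `A` by erasing all
off-diagonal entries. -/
def IsOffDiagonalErasure {ι : Type*} (b : HilbertBasis ι ℂ H) (A D : H →L[ℂ] H) : Prop :=
  (∀ i, ⟪b i, D (b i)⟫_ℂ = ⟪b i, A (b i)⟫_ℂ) ∧ ∀ i j, i ≠ j → ⟪b i, D (b j)⟫_ℂ = 0

end Operators

end EntropyNote

end

namespace EntropyNote

/-! ### Entropy as an integral over truncations, and contractions of `ell1`. -/

section Sequences

open MeasureTheory Set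

/-! For `x` in `[0, 1]` one has `∫₀¹ min(x, c)/c dc = x - x ln x`. Hence, for a family `α` of total
mass `1`, entropy plus `1` is the integral of `∑ min(αᵢ, c)` against `dc/c`, and `∑ min(αᵢ, c) = 1 -
∑ (αᵢ - c)₊`. So entropy grows as soon as `∑ (αᵢ - c)₊` shrinks for every `c > 0`
(`tsum_negMulLog_le`).

To see that it shrinks, split `ω` into `(ω - c)₊`, whose 1-norm is `∑ (αᵢ - c)₊`, and `min(ω, c)`,
whose sup norm is at most `c`. After applying `T` the second piece still contributes at most `c` to
each entry, so the excess over `c` comes from the first piece, whose 1-norm has not grown.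

For operators the same splitting is made in an eigenbasis of `ω` (`exists_truncation`), and the
excess is measured in an eigenbasis of `T ω` through `∑ |⟨bᵢ, A bᵢ⟩| ≤ ‖A‖₁`
(`tsum_ofReal_inner_sub_le_traceNorm`). Both eigenbases exist because density operators are compact.
For the erasure `D` no map is needed: its eigenvalues are the diagonal entries of `ω` itself, so the
estimate applies directly to the splitting of `ω`. -/

lemma lintegral_min_div {x : ℝ} (h0 : 0 ≤ x) (h1 : x ≤ 1) :
    ∫⁻ c in Ioc (0 : ℝ) 1, ENNReal.ofReal (min x c / c) =
      ENNReal.ofReal (Real.negMulLog x) + ENNReal.ofReal x := by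
  rcases h0.eq_or_lt with rfl | hx
  · rw [setLIntegral_congr_fun (g := fun _ => 0) measurableSet_Ioc]
    · simp
    · intro c hc
      simp [min_eq_left hc.1.le]
  -- The integrand is `1` up to `x` and `x / c` beyond it; the second range produces the logarithm.
  have e1 : ∫⁻ c in Ioc (0 : ℝ) x, ENNReal.ofReal (min x c / c) = ENNReal.ofReal x := by
    rw [setLIntegral_congr_fun (g := fun _ => 1) measurableSet_Ioc]
    · simp
    · intro c hc
      simp [min_eq_right hc.2, div_self hc.1.ne']
  have e2 : ∫⁻ c in Ioc x 1, ENNReal.ofReal (min x c / c) =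
      ENNReal.ofReal (Real.negMulLog x) := by
    have hint : IntervalIntegrable (fun c : ℝ => x * c⁻¹) volume x 1 := by
      refine (ContinuousOn.mul continuousOn_const
        (continuousOn_id.inv₀ fun c hc => ?_)).intervalIntegrable
      rw [uIcc_of_le h1] at hc
      exact (hx.trans_le hc.1).ne'
    rw [setLIntegral_congr_fun (g := fun c => ENNReal.ofReal (x * c⁻¹)) measurableSet_Ioc,
      ← ofReal_integral_eq_lintegral_ofReal
        ((intervalIntegrable_iff_integrableOn_Ioc_of_le h1).1 hint),
      ← intervalIntegral.integral_of_le h1, intervalIntegral.integral_const_mul,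
      integral_inv_of_pos hx one_pos]
    · simp [Real.negMulLog]
    · refine (ae_restrict_mem measurableSet_Ioc).mono fun c hc => ?_
      have := hx.trans hc.1
      simp only [Pi.zero_apply]
      positivity
    · intro c hc
      simp only [min_eq_left hc.1.le, div_eq_mul_inv]
  rw [← Ioc_union_Ioc_eq_Ioc hx.le h1, lintegral_union measurableSet_Ioc
    (Ioc_disjoint_Ioc_of_le le_rfl), e1, e2, add_comm]

/-- The entropy of a family of numbers, written as an integral over truncations. -/
lemma tsum_negMulLog_add_tsum {ι : Type*} [Countable ι] {α : ι → ℝ} (h0 : ∀ i, 0 ≤ α i)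
    (h1 : ∀ i, α i ≤ 1) :
    ∑' i, ENNReal.ofReal (Real.negMulLog (α i)) + ∑' i, ENNReal.ofReal (α i) =
      ∫⁻ c in Ioc (0 : ℝ) 1, (∑' i, ENNReal.ofReal (min (α i) c)) * ENNReal.ofReal c⁻¹ := by
  rw [← ENNReal.tsum_add]
  simp only [← ENNReal.tsum_mul_right]
  rw [lintegral_tsum fun i => by fun_prop]
  refine tsum_congr fun i => ?_
  rw [← lintegral_min_div (h0 i) (h1 i)]
  refine setLIntegral_congr_fun measurableSet_Ioc fun c hc => ?_
  rw [div_eq_mul_inv, ENNReal.ofReal_mul (le_min (h0 i) hc.1.le)]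

lemma le_one_of_tsum_eq_one {ι : Type*} {α : ι → ℝ} (h : ∑' i, ENNReal.ofReal (α i) = 1) (i : ι) :
    α i ≤ 1 := by
  rw [← ENNReal.ofReal_le_one, ← h]
  exact ENNReal.le_tsum i

lemma ofReal_min_add_ofReal_sub {c x : ℝ} (hc : 0 < c) :
    ENNReal.ofReal (min x c) + ENNReal.ofReal (x - c) = ENNReal.ofReal x := by
  rcases le_total x c with h | h
  · rw [min_eq_left h, ENNReal.ofReal_of_nonpos (sub_nonpos.2 h), add_zero]
  · rw [min_eq_right h, ← ENNReal.ofReal_add hc.le (sub_nonneg.2 h), add_sub_cancel]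

/-- If `∑ (βⱼ - c)₊ ≤ ∑ (αᵢ - c)₊` for all `c`, then `β` has at least the entropy of `α`. -/
theorem tsum_negMulLog_le {ι κ : Type*} [Countable ι] [Countable κ] {α : ι → ℝ} {β : κ → ℝ}
    (hα : ∀ i, 0 ≤ α i) (hβ : ∀ j, 0 ≤ β j) (hα1 : ∑' i, ENNReal.ofReal (α i) = 1)
    (hβ1 : ∑' j, ENNReal.ofReal (β j) = 1)
    (h : ∀ c, 0 < c → ∑' j, ENNReal.ofReal (β j - c) ≤ ∑' i, ENNReal.ofReal (α i - c)) :
    ∑' i, ENNReal.ofReal (Real.negMulLog (α i)) ≤ ∑' j, ENNReal.ofReal (Real.negMulLog (β j)) := by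
  have key := tsum_negMulLog_add_tsum hα (le_one_of_tsum_eq_one hα1)
  have key' := tsum_negMulLog_add_tsum hβ (le_one_of_tsum_eq_one hβ1)
  rw [hα1] at key
  rw [hβ1] at key'
  -- Adding the total mass `1` to both entropies turns them into integrals, compared pointwise in
  -- `c`.
  rw [← ENNReal.add_le_add_iff_right ENNReal.one_ne_top, key, key']
  refine setLIntegral_mono' measurableSet_Ioc fun c hc => ?_
  gcongr ?_ * _
  have sα : ∑' i, ENNReal.ofReal (min (α i) c) + ∑' i, ENNReal.ofReal (α i - c) = 1 := by
    rw [← ENNReal.tsum_add, ← hα1]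
    exact tsum_congr fun i => ofReal_min_add_ofReal_sub hc.1
  have sβ : ∑' i, ENNReal.ofReal (min (β i) c) + ∑' i, ENNReal.ofReal (β i - c) = 1 := by
    rw [← ENNReal.tsum_add, ← hβ1]
    exact tsum_congr fun i => ofReal_min_add_ofReal_sub hc.1
  -- Finiteness permits cancellation in `ℝ≥0∞`; passing to the complement in `1` reverses the
  -- inequality `h`.
  have hfin : ∑' i, ENNReal.ofReal (α i - c) ≠ ∞ :=
    ne_top_of_le_ne_top ENNReal.one_ne_top (sα ▸ le_add_self)
  rw [← ENNReal.add_le_add_iff_right hfin, sα, ← sβ]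
  gcongr
  exact h c hc.1

theorem seqEntropy_le_of_contraction {𝕜 : Type*} [RCLike 𝕜] (T : ell1 𝕜 →ₗ[ℝ] ell1 𝕜)
    (h1 : ∀ x, ‖T x‖ ≤ ‖x‖) (hsup : ∀ x, supNorm (T x) ≤ supNorm x) {ω : ell1 𝕜}
    (hω : ω ∈ probabilitySequences 𝕜) (hTω : T ω ∈ probabilitySequences 𝕜) :
    seqEntropy (fun n => RCLike.re (ω n)) ≤ seqEntropy (fun n => RCLike.re (T ω n)) := by
  have sum_one : ∀ {x : ell1 𝕜}, x ∈ probabilitySequences 𝕜 →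
      (∀ n, 0 ≤ RCLike.re (x n)) ∧ ∑' n, ENNReal.ofReal (RCLike.re (x n)) = 1 := by
    intro x hx
    have h0 : ∀ n, 0 ≤ RCLike.re (x n) := fun n => (RCLike.nonneg_iff.1 (hx.1 n)).1
    have hs : HasSum (fun n => RCLike.re (x n)) 1 := by
      simpa using RCLike.hasSum_re 𝕜 hx.2
    refine ⟨h0, ?_⟩
    rw [← ENNReal.ofReal_tsum_of_nonneg h0 hs.summable, hs.tsum_eq, ENNReal.ofReal_one]
  have enorm_eq : ∀ x : ell1 𝕜, ENNReal.ofReal ‖x‖ = ∑' n, ‖x n‖ₑ := by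
    intro x
    have hs := lp.hasSum_norm (p := 1) (by simp) x
    simp only [ENNReal.toReal_one, Real.rpow_one] at hs
    rw [← hs.tsum_eq, ENNReal.ofReal_tsum_of_nonneg (fun n => norm_nonneg _) hs.summable]
    simp
  obtain ⟨hω0, hω1⟩ := sum_one hω
  obtain ⟨hT0, hT1⟩ := sum_one hTω
  refine tsum_negMulLog_le hω0 hT0 hω1 hT1 fun c hc => ?_
  -- This is `(ω - c)₊`, so that `ω - a = min(ω, c)`.
  let a : ell1 𝕜 := ⟨fun n => ((max (RCLike.re (ω n) - c) 0 : ℝ) : 𝕜), by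
    refine (lp.memℓp ω).mono' fun n => ?_
    rw [RCLike.norm_ofReal, abs_of_nonneg (le_max_right _ _)]
    have := RCLike.re_le_norm (ω n)
    exact max_le (by linarith) (norm_nonneg _)⟩
  have ha : ∀ n, a n = ((max (RCLike.re (ω n) - c) 0 : ℝ) : 𝕜) := fun n => rfl
  have hna : ∀ n, ‖a n‖ₑ = ENNReal.ofReal (RCLike.re (ω n) - c) := fun n => by
    rw [ha, ← ofReal_norm, RCLike.norm_ofReal, abs_of_nonneg (le_max_right _ _),
      ENNReal.ofReal_max, ENNReal.ofReal_zero, max_eq_left zero_le]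
  have hb : supNorm (T (ω - a)) ≤ ENNReal.ofReal c := by
    refine (hsup _).trans (iSup_le fun n => ?_)
    -- Nonnegativity in `𝕜` forces the imaginary part to vanish.
    have hre : ω n = ((RCLike.re (ω n) : ℝ) : 𝕜) :=
      (RCLike.conj_eq_iff_re.1 (RCLike.conj_eq_iff_im.2 (RCLike.nonneg_iff.1 (hω.1 n)).2)).symm
    rw [lp.coeFn_sub, Pi.sub_apply, ha, ← ofReal_norm]
    apply ENNReal.ofReal_le_ofReal
    have : ω n - ((max (RCLike.re (ω n) - c) 0 : ℝ) : 𝕜) =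
        ((RCLike.re (ω n) - max (RCLike.re (ω n) - c) 0 : ℝ) : 𝕜) := by
      rw [RCLike.ofReal_sub, ← hre]
    rw [this, RCLike.norm_ofReal, abs_le]
    have := hω0 n
    rcases max_cases (RCLike.re (ω n) - c) 0 with h | h <;> constructor <;> linarith
  calc ∑' n, ENNReal.ofReal (RCLike.re (T ω n) - c)
      ≤ ∑' n, ‖T a n‖ₑ := by
        refine ENNReal.tsum_le_tsum fun n => ?_
        rw [← ofReal_norm]
        apply ENNReal.ofReal_le_ofReal
        have e : T ω n = T a n + T (ω - a) n := by
          rw [← Pi.add_apply, ← lp.coeFn_add, ← map_add, add_sub_cancel]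
        have e2 : ‖T (ω - a) n‖ ≤ c := by
          rw [← ENNReal.ofReal_le_ofReal_iff hc.le, ofReal_norm]
          exact (le_iSup (fun n => ‖T (ω - a) n‖ₑ) n).trans hb
        have e3 := RCLike.re_le_norm (T a n)
        have e4 := RCLike.re_le_norm (T (ω - a) n)
        rw [e, map_add]
        linarith
    _ = ENNReal.ofReal ‖T a‖ := (enorm_eq _).symm
    _ ≤ ENNReal.ofReal ‖a‖ := ENNReal.ofReal_le_ofReal (h1 a)
    _ = ∑' n, ENNReal.ofReal (RCLike.re (ω n) - c) := by
        rw [enorm_eq]; exact tsum_congr hna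

end Sequences

section Operators

open Filter Topology Module.End

variable {H : Type*} [NormedAddCommGroup H] [InnerProductSpace ℂ H] [CompleteSpace H]

omit [CompleteSpace H] in
-- Distinct basis vectors are `√2` apart, so balls of radius `1/2` around them are disjoint.
-- Countability is what allows sum and integral to be exchanged in `tsum_negMulLog_add_tsum`.
lemma countable_of_hilbertBasis [TopologicalSpace.SeparableSpace H] {ι : Type*}
    (b : HilbertBasis ι ℂ H) : Countable ι := by
  refine Pairwise.countable_of_isOpen_disjoint (s := fun i => Metric.ball (b i) (1 / 2)) ?_
    (fun _ => Metric.isOpen_ball) fun _ => ⟨_, Metric.mem_ball_self (by norm_num)⟩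
  intro i j hij
  refine Metric.ball_disjoint_ball ?_
  have h := norm_sub_sq (𝕜 := ℂ) (b i) (b j)
  rw [b.orthonormal.2 hij, b.orthonormal.1, b.orthonormal.1] at h
  rw [dist_eq_norm]
  simp only [map_zero] at h
  nlinarith [norm_nonneg (b i - b j)]

omit [CompleteSpace H] in
lemma ext_hilbertBasis {ι : Type*} (b : HilbertBasis ι ℂ H) {x y : H}
    (h : ∀ i, ⟪b i, x⟫_ℂ = ⟪b i, y⟫_ℂ) : x = y := by
  apply b.repr.injective
  ext i
  rw [b.repr_apply_apply, b.repr_apply_apply, h]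

/-! ### Traces of positive operators and the trace norm in an arbitrary basis. -/

lemma sqrt_isPositive (A : H →L[ℂ] H) : (CFC.sqrt A).IsPositive :=
  (ContinuousLinearMap.nonneg_iff_isPositive _).1 (CFC.sqrt_nonneg _)

lemma sqrt_sqrt_apply {A : H →L[ℂ] H} (hA : A.IsPositive) (x : H) :
    CFC.sqrt A (CFC.sqrt A x) = A x := by
  rw [← mul_apply_eq_comp, CFC.sqrt_mul_sqrt_self _
    ((ContinuousLinearMap.nonneg_iff_isPositive _).2 hA)]

lemma ofReal_inner_eq_enorm_sqrt_sq {A : H →L[ℂ] H} (hA : A.IsPositive) (x : H) :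
    ENNReal.ofReal (⟪x, A x⟫_ℂ).re = ‖CFC.sqrt A x‖ₑ ^ 2 := by
  rw [← sqrt_sqrt_apply hA, ← (sqrt_isPositive A).inner_left_eq_inner_right,
    inner_self_eq_norm_sq_to_K, ← ofReal_norm, ← ENNReal.ofReal_pow (norm_nonneg _)]
  congr 1
  norm_cast

/-- Both sides are squared Hilbert–Schmidt norms of the self-adjoint operator `√A`, and these do not
depend on the basis. -/
lemma tsum_ofReal_inner_eq {ι κ : Type*} (b : HilbertBasis ι ℂ H) (c : HilbertBasis κ ℂ H)
    {A : H →L[ℂ] H} (hA : A.IsPositive) :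
    ∑' i, ENNReal.ofReal (⟪b i, A (b i)⟫_ℂ).re = ∑' j, ENNReal.ofReal (⟪c j, A (c j)⟫_ℂ).re := by
  simp only [ofReal_inner_eq_enorm_sqrt_sq hA]
  rw [tsum_enorm_adjoint_sq b c, (sqrt_isPositive A).isSelfAdjoint.adjoint_eq]

lemma traceNorm_of_isPositive {ι : Type*} (b : HilbertBasis ι ℂ H) {A : H →L[ℂ] H}
    (hA : A.IsPositive) : traceNorm A = ∑' i, ENNReal.ofReal (⟪b i, A (b i)⟫_ℂ).re := by
  rw [tsum_ofReal_inner_eq b (someBasis H) hA, traceNorm,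
    CFC.abs_of_nonneg _ ((ContinuousLinearMap.nonneg_iff_isPositive _).2 hA)]

omit [CompleteSpace H] in
lemma inner_eq_ofReal_re {A : H →L[ℂ] H} (hA : A.IsPositive) (x : H) :
    ⟪x, A x⟫_ℂ = ((⟪x, A x⟫_ℂ).re : ℂ) :=
  Complex.ext rfl (Complex.nonneg_iff.1 (hA.inner_nonneg_right x)).2.symm

/-- Frees the definition from `someBasis`: for positive `A`, a single equation in `ℝ≥0∞` encodes
both finiteness and the value of the trace, in whichever basis is convenient. -/
lemma isDensityOperator_iff {ι : Type*} (b : HilbertBasis ι ℂ H) {A : H →L[ℂ] H} :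
    IsDensityOperator A ↔
      A.IsPositive ∧ ∑' i, ENNReal.ofReal (⟪b i, A (b i)⟫_ℂ).re = 1 := by
  refine and_congr_right fun hA => ?_
  have h0 : ∀ i, 0 ≤ (⟪someBasis H i, A (someBasis H i)⟫_ℂ).re := fun i =>
    (Complex.nonneg_iff.1 (hA.inner_nonneg_right _)).1
  rw [tsum_ofReal_inner_eq b (someBasis H) hA, IsTraceClass,
    traceNorm_of_isPositive (someBasis H) hA]
  have htr : trace A = ((∑' i, (⟪someBasis H i, A (someBasis H i)⟫_ℂ).re : ℝ) : ℂ) := by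
    rw [Complex.ofReal_tsum]
    exact tsum_congr fun i => inner_eq_ofReal_re hA _
  rw [htr]
  constructor
  · rintro ⟨h1, h2⟩
    have hs := ENNReal.summable_toReal h1
    simp only [ENNReal.toReal_ofReal (h0 _)] at hs
    rw [← ENNReal.ofReal_tsum_of_nonneg h0 hs]
    have h3 : ∑' i, (⟪someBasis H i, A (someBasis H i)⟫_ℂ).re = 1 := by exact_mod_cast h2
    rw [h3, ENNReal.ofReal_one]
  · intro h
    have h1 : ∑' i, ENNReal.ofReal (⟪someBasis H i, A (someBasis H i)⟫_ℂ).re ≠ ∞ := by simp [h]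
    refine ⟨h1, ?_⟩
    have h2 := ENNReal.tsum_toReal_eq (fun i => ENNReal.ne_top_of_tsum_ne_top h1 i)
    simp only [ENNReal.toReal_ofReal (h0 _)] at h2
    rw [← h2, h, ENNReal.toReal_one, Complex.ofReal_one]

/-- With `A = U|A|` and `S = √|A|`, each diagonal entry is `⟨S U* bᵢ, S bᵢ⟩`. Cauchy–Schwarz and
`2xy ≤ x² + y²` bound it by Hilbert–Schmidt terms, and composing `S` with the contraction `U*` does
not increase the Hilbert–Schmidt norm. -/
lemma tsum_enorm_inner_self_le_traceNorm {ι : Type*} (b : HilbertBasis ι ℂ H) (A : H →L[ℂ] H) :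
    ∑' i, ‖⟪b i, A (b i)⟫_ℂ‖ₑ ≤ traceNorm A := by
  obtain ⟨U, hU, hUA⟩ := exists_contraction_comp_eq A (CFC.abs A)
    (fun x => (norm_abs_apply A x).ge)
  have hP : (CFC.abs A).IsPositive :=
    (ContinuousLinearMap.nonneg_iff_isPositive _).1 (CFC.abs_nonneg A)
  set S : H →L[ℂ] H := CFC.sqrt (CFC.abs A)
  have hS : S.IsPositive := sqrt_isPositive _
  have htr : traceNorm A = ∑' i, ‖S (b i)‖ₑ ^ 2 := by
    rw [traceNorm, tsum_ofReal_inner_eq (someBasis H) b hP]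
    exact tsum_congr fun i => ofReal_inner_eq_enorm_sqrt_sq hP _
  have hW : ‖ContinuousLinearMap.adjoint U‖ ≤ 1 := by rwa [LinearIsometryEquiv.norm_map]
  have hW' := tsum_enorm_comp_sq_le b S _ hW hS
  have key : ∀ i, 2 * ‖⟪b i, A (b i)⟫_ℂ‖ₑ ≤
      ‖S (ContinuousLinearMap.adjoint U (b i))‖ₑ ^ 2 + ‖S (b i)‖ₑ ^ 2 := fun i => by
    have h1 : ⟪b i, A (b i)⟫_ℂ = ⟪S (ContinuousLinearMap.adjoint U (b i)), S (b i)⟫_ℂ := by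
      rw [hS.inner_left_eq_inner_right, sqrt_sqrt_apply hP,
        ContinuousLinearMap.adjoint_inner_left, hUA]
    rw [h1]
    simp only [← ofReal_norm, ← ENNReal.ofReal_pow (norm_nonneg _)]
    rw [← ENNReal.ofReal_add (by positivity) (by positivity),
      show (2 : ℝ≥0∞) = ENNReal.ofReal 2 by simp, ← ENNReal.ofReal_mul (by norm_num)]
    apply ENNReal.ofReal_le_ofReal
    have := norm_inner_le_norm (𝕜 := ℂ) (S (ContinuousLinearMap.adjoint U (b i))) (S (b i))
    nlinarith [sq_nonneg (‖S (ContinuousLinearMap.adjoint U (b i))‖ - ‖S (b i)‖)]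
  have h2 : 2 * ∑' i, ‖⟪b i, A (b i)⟫_ℂ‖ₑ ≤ 2 * traceNorm A := by
    rw [← ENNReal.tsum_mul_left]
    refine (ENNReal.tsum_le_tsum key).trans ?_
    rw [ENNReal.tsum_add, two_mul, htr]
    gcongr
  exact (ENNReal.mul_le_mul_iff_right (by norm_num) (by norm_num)).1 h2

/-- Diagonal entries of `Y` are at most `c` in modulus, so any excess over `c` is paid for by `X`.
-/
lemma tsum_ofReal_inner_sub_le_traceNorm {ι : Type*} (b : HilbertBasis ι ℂ H)
    (X Y : H →L[ℂ] H) {c : ℝ} (hY : ‖Y‖ ≤ c) :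
    ∑' i, ENNReal.ofReal ((⟪b i, (X + Y) (b i)⟫_ℂ).re - c) ≤ traceNorm X := by
  refine (ENNReal.tsum_le_tsum fun i => ?_).trans (tsum_enorm_inner_self_le_traceNorm b X)
  rw [← ofReal_norm]
  apply ENNReal.ofReal_le_ofReal
  rw [_root_.add_apply, inner_add_right, Complex.add_re]
  have h1 := Complex.re_le_norm ⟪b i, X (b i)⟫_ℂ
  have h2 := Complex.re_le_norm ⟪b i, Y (b i)⟫_ℂ
  have h3 := norm_inner_le_norm (𝕜 := ℂ) (b i) (Y (b i))
  have h4 := Y.le_opNorm (b i)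
  rw [b.orthonormal.1] at h3 h4
  linarith

/-! ### Diagonal operators, compactness and eigenbases. -/

omit [CompleteSpace H] in
/-- Diagonal operators in an orthonormal basis. -/
lemma exists_diagonal {ι : Type*} (b : HilbertBasis ι ℂ H) (d : ι → ℝ) {C : ℝ} (hC : 0 ≤ C)
    (hd : ∀ i, |d i| ≤ C) :
    ∃ D : H →L[ℂ] H, ‖D‖ ≤ C ∧ ∀ i x, ⟪b i, D x⟫_ℂ = d i * ⟪b i, x⟫_ℂ := by
  have hle : ∀ (f : lp (fun _ : ι => ℂ) 2) (i : ι), ‖(d i : ℂ) * f i‖ ≤ ‖((C : ℂ) • f) i‖ := by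
    intro f i
    rw [lp.coeFn_smul, Pi.smul_apply, smul_eq_mul, norm_mul, norm_mul, Complex.norm_real,
      Complex.norm_real, Real.norm_eq_abs, Real.norm_of_nonneg hC]
    gcongr
    exact hd i
  have hmem : ∀ f : lp (fun _ : ι => ℂ) 2, Memℓp (fun i => (d i : ℂ) * f i) 2 := fun f =>
    (lp.memℓp ((C : ℂ) • f)).mono' (hle f)
  let M : lp (fun _ : ι => ℂ) 2 →ₗ[ℂ] lp (fun _ : ι => ℂ) 2 :=
    { toFun := fun f => ⟨fun i => (d i : ℂ) * f i, hmem f⟩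
      map_add' := fun f g => by ext i; exact mul_add _ _ _
      map_smul' := fun c f => by ext i; exact mul_left_comm _ _ _ }
  have hM : ∀ f, ‖M f‖ ≤ C * ‖f‖ := fun f => by
    have : ‖M f‖ ≤ ‖(C : ℂ) • f‖ := lp.norm_mono (by norm_num) (hle f)
    rwa [norm_smul, Complex.norm_real, Real.norm_of_nonneg hC] at this
  refine ⟨LinearMap.mkContinuous
    (b.repr.symm.toLinearEquiv.toLinearMap ∘ₗ M ∘ₗ b.repr.toLinearEquiv.toLinearMap) C
    fun x => ?_, LinearMap.mkContinuous_norm_le _ hC _, fun i x => ?_⟩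
  · simpa using hM (b.repr x)
  · rw [← b.repr_apply_apply, ← b.repr_apply_apply]
    simp [M]

omit [CompleteSpace H] in
lemma isPositive_of_diagonal {ι : Type*} (b : HilbertBasis ι ℂ H) {d : ι → ℝ}
    (hd : ∀ i, 0 ≤ d i) {D : H →L[ℂ] H} (hD : ∀ i x, ⟪b i, D x⟫_ℂ = d i * ⟪b i, x⟫_ℂ) :
    D.IsPositive := by
  have hD' : ∀ i x, ⟪D x, b i⟫_ℂ = d i * ⟪x, b i⟫_ℂ := fun i x => by
    rw [← inner_conj_symm, hD, map_mul, Complex.conj_ofReal, inner_conj_symm]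
  refine ⟨fun x y => ?_, fun x => ?_⟩
  · change ⟪D x, y⟫_ℂ = ⟪x, D y⟫_ℂ
    rw [← b.tsum_inner_mul_inner, ← b.tsum_inner_mul_inner x]
    refine tsum_congr fun i => ?_
    rw [hD, hD']
    ring
  · change 0 ≤ RCLike.re ⟪D x, x⟫_ℂ
    rw [← (RCLike.hasSum_re ℂ (b.hasSum_inner_mul_inner (D x) x)).tsum_eq]
    refine tsum_nonneg fun i => ?_
    rw [hD', mul_assoc, ← inner_conj_symm x, Complex.conj_mul']
    rw [← Complex.ofReal_pow, ← Complex.ofReal_mul]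
    exact mul_nonneg (hd i) (sq_nonneg _)

lemma isCompactOperator_of_tsum_enorm_sq_ne_top {ι : Type*} (b : HilbertBasis ι ℂ H)
    {S : H →L[ℂ] H} (hS : IsSelfAdjoint S) (h : ∑' i, ‖S (b i)‖ₑ ^ 2 ≠ ∞) :
    IsCompactOperator S := by
  classical
  -- `F s` is `S` followed by the orthogonal projection onto the span of `b i`, `i ∈ s`. These
  -- finite rank operators converge to `S` in norm, since the squared error is at most the tail of
  -- the Hilbert–Schmidt sum.
  let F : Finset ι → H →L[ℂ] H := fun s =>
    ∑ i ∈ s, (ContinuousLinearMap.toSpanSingleton ℂ (b i)).comp (innerSL ℂ (S (b i)))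
  have hF : ∀ s x, F s x = ∑ i ∈ s, ⟪b i, S x⟫_ℂ • b i := fun s x => by
    simp only [F, sum_apply]
    refine Finset.sum_congr rfl fun i _ => ?_
    rw [ContinuousLinearMap.comp_apply, ContinuousLinearMap.toSpanSingleton_apply,
      innerSL_apply_apply, ← ContinuousLinearMap.adjoint_inner_left, hS.adjoint_eq]
  have hcoef : ∀ s x i, ⟪b i, (F s - S) x⟫_ℂ = if i ∈ s then 0 else -⟪b i, S x⟫_ℂ := by
    intro s x i
    rw [_root_.sub_apply, inner_sub_right, hF, inner_sum]
    simp only [inner_smul_right, orthonormal_iff_ite.1 b.orthonormal, mul_ite, mul_one, mul_zero,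
      Finset.sum_ite_eq]
    split_ifs <;> simp
  have hbound : ∀ s, ‖F s - S‖ₑ ^ 2 ≤ ∑' i : { i // i ∉ s }, ‖S (b i)‖ₑ ^ 2 := by
    intro s
    set t := ∑' i : { i // i ∉ s }, ‖S (b i)‖ₑ ^ 2 with ht
    have htop : t ≠ ∞ := ne_top_of_le_ne_top h
      (ENNReal.tsum_comp_le_tsum_of_injective Subtype.val_injective _)
    have hx : ∀ x, ‖(F s - S) x‖ₑ ^ 2 ≤ t * ‖x‖ₑ ^ 2 := by
      intro x
      rw [← tsum_enorm_inner_sq b, ht, ← ENNReal.tsum_mul_right]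
      refine le_of_le_of_eq (ENNReal.tsum_le_tsum fun i => ?_)
        (tsum_subtype {i | i ∉ s} fun i => ‖S (b i)‖ₑ ^ 2 * ‖x‖ₑ ^ 2).symm
      rw [hcoef]
      by_cases hi : i ∈ s
      · simp [hi]
      · rw [if_neg hi, Set.indicator_of_mem (show i ∈ {i | i ∉ s} from hi), enorm_neg, ← mul_pow]
        gcongr
        rw [← ContinuousLinearMap.adjoint_inner_left, hS.adjoint_eq, ← ofReal_norm, ← ofReal_norm,
          ← ofReal_norm, ← ENNReal.ofReal_mul (norm_nonneg _)]
        exact ENNReal.ofReal_le_ofReal (norm_inner_le_norm _ _)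
    have hn : ‖F s - S‖ ≤ √t.toReal := by
      refine ContinuousLinearMap.opNorm_le_bound _ (Real.sqrt_nonneg _) fun x => ?_
      refine (sq_le_sq₀ (norm_nonneg _) (by positivity)).1 ?_
      rw [mul_pow, Real.sq_sqrt ENNReal.toReal_nonneg]
      have := ENNReal.toReal_mono (ENNReal.mul_ne_top htop (by simp)) (hx x)
      simpa using this
    rw [← ofReal_norm, ← ENNReal.ofReal_pow (norm_nonneg _)]
    refine ENNReal.ofReal_le_of_le_toReal ?_
    rw [← Real.sq_sqrt (ENNReal.toReal_nonneg (a := t))]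
    gcongr
  have hlim : Tendsto F atTop (𝓝 S) := by
    rw [tendsto_iff_norm_sub_tendsto_zero]
    have h1 : Tendsto (fun s => ‖F s - S‖ₑ ^ 2) atTop (𝓝 0) :=
      tendsto_of_tendsto_of_tendsto_of_le_of_le tendsto_const_nhds
        (ENNReal.tendsto_tsum_compl_atTop_zero h) (fun _ => bot_le) hbound
    have h2 := (ENNReal.tendsto_toReal ENNReal.zero_ne_top).comp h1
    have h3 := (Real.continuous_sqrt.tendsto _).comp h2
    simpa [Function.comp_def, Real.sqrt_sq] using h3
  refine isCompactOperator_of_tendsto hlim (Eventually.of_forall fun s => ?_)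
  refine sum_mem (S := compactOperator (RingHom.id ℂ) H H) fun i _ => ?_
  have hi : IsCompactOperator (ContinuousLinearMap.toSpanSingleton ℂ (b i)) :=
    isCompactOperator_of_locallyCompactSpace_rng _
  exact hi.comp_clm (innerSL ℂ (S (b i)))

/-- The trace of `A` is the squared Hilbert–Schmidt norm of `√A`; hence `√A` is compact, and so is
its square. -/
lemma isCompactOperator_of_isDensityOperator {A : H →L[ℂ] H} (hA : IsDensityOperator A) :
    IsCompactOperator A := by
  have h : ∑' i, ‖CFC.sqrt A (someBasis H i)‖ₑ ^ 2 = 1 := by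
    simp only [← ofReal_inner_eq_enorm_sqrt_sq hA.1]
    exact ((isDensityOperator_iff _).1 hA).2
  have hc := isCompactOperator_of_tsum_enorm_sq_ne_top (someBasis H)
    (sqrt_isPositive A).isSelfAdjoint (by simp [h])
  convert! hc.comp_clm (CFC.sqrt A) using 1
  ext x
  exact (sqrt_sqrt_apply hA.1 x).symm

/-- A compact self-adjoint operator has an orthonormal basis of eigenvectors. -/
theorem exists_eigenbasis.{u} {H : Type u} [NormedAddCommGroup H] [InnerProductSpace ℂ H]
    [CompleteSpace H] {A : H →L[ℂ] H} (hc : IsCompactOperator A)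
    (hA : (A : H →ₗ[ℂ] H).IsSymmetric) :
    ∃ (κ : Type u) (b : HilbertBasis κ ℂ H) (α : κ → ℝ), ∀ i, A (b i) = (α i : ℂ) • b i := by
  have hcomp : ∀ μ : ℂ, CompleteSpace (eigenspace (A : H →ₗ[ℂ] H) μ) := fun μ => by
    refine (?_ : IsClosed (eigenspace (A : H →ₗ[ℂ] H) μ : Set H)).completeSpace_coe
    have : (eigenspace (A : H →ₗ[ℂ] H) μ : Set H) = {x | A x = μ • x} := by
      ext x
      simp
    rw [this]
    exact isClosed_eq A.continuous (continuous_const_smul μ)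
  choose w e _ using fun μ : ℂ => exists_hilbertBasis ℂ (eigenspace (A : H →ₗ[ℂ] H) μ)
  have ho : Orthonormal ℂ fun i : Σ μ, w μ => ((e i.1 i.2 : eigenspace (A : H →ₗ[ℂ] H) i.1) : H) :=
    hA.orthogonalFamily_eigenspaces.orthonormal_sigma_orthonormal fun μ => (e μ).orthonormal
  -- The union of the bases of the eigenspaces is total: a vector orthogonal to it is orthogonal to
  -- every eigenspace, hence zero by the spectral theorem for compact operators.
  have hbot : (Submodule.span ℂ (Set.range
      fun i : Σ μ, w μ => ((e i.1 i.2 : eigenspace (A : H →ₗ[ℂ] H) i.1) : H)))ᗮ = ⊥ := by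
    rw [eq_bot_iff, ← ContinuousLinearMap.orthogonalComplement_iSup_eigenspaces_eq_bot hc hA,
      ← Submodule.iInf_orthogonal]
    intro v hv
    refine (Submodule.mem_iInf _).2 fun μ x hx => ?_
    have h1 := (e μ).hasSum_repr ⟨x, hx⟩
    have h2 := (((innerSL ℂ v).comp (eigenspace (A : H →ₗ[ℂ] H) μ).subtypeL).hasSum h1).tsum_eq
    rw [← inner_eq_zero_symm]
    refine h2.symm.trans ((tsum_congr fun i => ?_).trans tsum_zero)
    have h3 : ⟪v, ((e μ i : eigenspace (A : H →ₗ[ℂ] H) μ) : H)⟫_ℂ = 0 :=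
      Submodule.inner_left_of_mem_orthogonal
        (Submodule.subset_span (Set.mem_range_self (⟨μ, i⟩ : Σ μ, w μ))) hv
    simp [h3]
  refine ⟨_, HilbertBasis.mkOfOrthogonalEqBot ho hbot, fun i => i.1.re, fun i => ?_⟩
  rw [HilbertBasis.coe_mkOfOrthogonalEqBot]
  have hmem := (e i.1 i.2).2
  have hne : ((e i.1 i.2 : eigenspace (A : H →ₗ[ℂ] H) i.1) : H) ≠ 0 := ho.ne_zero i
  -- The eigenvalue is real by symmetry, so taking its real part loses nothing.
  have hconj := hA.conj_eigenvalue_eq_self (hasEigenvalue_of_hasEigenvector ⟨hmem, hne⟩)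
  rw [Complex.conj_eq_iff_re.1 hconj]
  exact mem_eigenspace_iff.1 hmem

omit [CompleteSpace H] in
lemma apply_eq_smul_of_diagonal {ι : Type*} (b : HilbertBasis ι ℂ H) {d : ι → ℝ} {D : H →L[ℂ] H}
    (hD : ∀ i x, ⟪b i, D x⟫_ℂ = d i * ⟪b i, x⟫_ℂ) (i : ι) : D (b i) = (d i : ℂ) • b i := by
  classical
  refine ext_hilbertBasis b fun j => ?_
  rw [hD, inner_smul_right, orthonormal_iff_ite.1 b.orthonormal]
  split_ifs with h
  · rw [h]
  · simp

omit [CompleteSpace H] in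
lemma inner_apply_of_eigenbasis {ι : Type*} (b : HilbertBasis ι ℂ H) {α : ι → ℝ} {A : H →L[ℂ] H}
    (hA : (A : H →ₗ[ℂ] H).IsSymmetric) (h : ∀ i, A (b i) = (α i : ℂ) • b i) (i : ι) (x : H) :
    ⟪b i, A x⟫_ℂ = α i * ⟪b i, x⟫_ℂ := by
  have := hA (b i) x
  simp only [ContinuousLinearMap.coe_coe] at this
  rw [← this, h, inner_smul_left, Complex.conj_ofReal]

omit [CompleteSpace H] in
lemma re_inner_eigenbasis {ι : Type*} (b : HilbertBasis ι ℂ H) {α : ι → ℝ} {A : H →L[ℂ] H}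
    (h : ∀ i, A (b i) = (α i : ℂ) • b i) (i : ι) : (⟪b i, A (b i)⟫_ℂ).re = α i := by
  rw [h, inner_smul_right, inner_self_eq_norm_sq_to_K, b.orthonormal.1]
  simp

/-! ### Entropy and truncation in terms of an eigenbasis. -/

omit [CompleteSpace H] in
-- The coefficients of a `μ`-eigenvector satisfy `(αᵢ - μ)⟨bᵢ, x⟩ = 0`, so it is expanded over the
-- fibre of `μ` alone; as the fibre is finite, the expansion is a finite sum.
lemma finrank_eigenspace_eq {ι : Type*} (b : HilbertBasis ι ℂ H) {α : ι → ℝ} {A : H →L[ℂ] H}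
    (h : ∀ i x, ⟪b i, A x⟫_ℂ = α i * ⟪b i, x⟫_ℂ) {μ : ℝ} (hfin : Finite {i // α i = μ}) :
    Module.finrank ℂ (eigenspace (A : H →ₗ[ℂ] H) (μ : ℂ)) = Nat.card {i // α i = μ} := by
  have := Fintype.ofFinite {i // α i = μ}
  have hspan : eigenspace (A : H →ₗ[ℂ] H) (μ : ℂ) =
      Submodule.span ℂ (Set.range fun i : {i // α i = μ} => b i) := by
    refine le_antisymm (fun x hx => ?_) (Submodule.span_le.2 ?_)
    · have hx' : A x = (μ : ℂ) • x := mem_eigenspace_iff.1 hx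
      have hz : ∀ i, α i ≠ μ → ⟪b i, x⟫_ℂ = 0 := fun i hi => by
        have h1 := h i x
        rw [hx', inner_smul_right] at h1
        have h2 : ((α i : ℂ) - μ) * ⟪b i, x⟫_ℂ = 0 := by rw [sub_mul, ← h1, sub_self]
        refine (mul_eq_zero.1 h2).resolve_left fun h3 => hi ?_
        exact_mod_cast sub_eq_zero.1 h3
      have hs := b.hasSum_repr x
      simp only [b.repr_apply_apply] at hs
      have hs' := (hasSum_subtype_iff_of_support_subset (s := {i | α i = μ}) (fun i hi => by
        by_contra hne
        exact hi (by simp only [hz i hne, zero_smul]))).2 hs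
      have hs'' : HasSum (fun i : {i // α i = μ} => ⟪b i, x⟫_ℂ • b i) x := hs'
      rw [hs''.unique (hasSum_fintype _)]
      exact Submodule.sum_mem _ fun i _ =>
        Submodule.smul_mem _ _ (Submodule.subset_span ⟨i, rfl⟩)
    · rintro _ ⟨i, rfl⟩
      refine mem_eigenspace_iff.2 ?_
      have := apply_eq_smul_of_diagonal b h i
      rwa [i.2] at this
  have hli : LinearIndependent ℂ fun i : {i // α i = μ} => b i :=
    b.orthonormal.linearIndependent.comp _ Subtype.val_injective
  rw [hspan, finrank_span_eq_card hli, Nat.card_eq_fintype_card]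

omit [CompleteSpace H] in
/-- The entropy of an operator, computed in an orthonormal basis of eigenvectors. -/
theorem operatorEntropy_eq_tsum {ι : Type*} (b : HilbertBasis ι ℂ H) {α : ι → ℝ} {A : H →L[ℂ] H}
    (h : ∀ i x, ⟪b i, A x⟫_ℂ = α i * ⟪b i, x⟫_ℂ) (hα : ∀ i, 0 ≤ α i)
    (hsum : ∑' i, ENNReal.ofReal (α i) ≠ ∞) :
    operatorEntropy A = ∑' i, ENNReal.ofReal (Real.negMulLog (α i)) := by
  rw [← (Equiv.sigmaFiberEquiv α).tsum_eq, ENNReal.tsum_sigma', operatorEntropy]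
  refine tsum_congr fun μ => ?_
  have hconst : ∀ i : {i // α i = μ},
      ENNReal.ofReal (Real.negMulLog (α (Equiv.sigmaFiberEquiv α ⟨μ, i⟩))) =
        ENNReal.ofReal (Real.negMulLog μ) := fun i => by
    rw [Equiv.sigmaFiberEquiv_apply, i.2]
  simp only [hconst]
  -- The eigenvalue `0` may have infinite multiplicity but has weight `0`. Any other fibre is finite
  -- because each of its members contributes `μ` to a finite sum.
  rcases eq_or_ne μ 0 with rfl | hμ
  · simp
  have hfin : Finite {i // α i = μ} := by
    rcases isEmpty_or_nonempty {i // α i = μ} with he | ⟨⟨i₀, hi₀⟩⟩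
    · infer_instance
    have hpos : 0 < μ := lt_of_le_of_ne (hi₀ ▸ hα i₀) hμ.symm
    refine Set.Finite.subset (ENNReal.finite_const_le_of_tsum_ne_top hsum
      (ε := ENNReal.ofReal μ) (by simpa using hpos)) fun i hi => ?_
    exact (congrArg ENNReal.ofReal hi).ge
  rw [finrank_eigenspace_eq b h hfin, ENNReal.tsum_const, ENat.card_eq_coe_natCard]
  simp

/-- The operators are `X = (A - c)₊` and `Y = min(A, c)`, both diagonal in the eigenbasis `b`. -/
lemma exists_truncation {ι : Type*} (b : HilbertBasis ι ℂ H) {α : ι → ℝ} {A : H →L[ℂ] H}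
    (h : ∀ i x, ⟪b i, A x⟫_ℂ = α i * ⟪b i, x⟫_ℂ) (hα : ∀ i, 0 ≤ α i) {C : ℝ}
    (hC : ∀ i, α i ≤ C) {c : ℝ} (hc : 0 < c) :
    ∃ X Y : H →L[ℂ] H, A = X + Y ∧ traceNorm X = ∑' i, ENNReal.ofReal (α i - c) ∧ ‖Y‖ ≤ c := by
  -- When `ι` is empty, `C` may be negative; hence the bound `max C 0`.
  obtain ⟨X, -, hX⟩ := exists_diagonal b (fun i => max (α i - c) 0) (C := max C 0)
    (le_max_right _ _) fun i => by
      rw [abs_of_nonneg (le_max_right _ _)]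
      exact max_le_max (by linarith [hC i]) le_rfl
  obtain ⟨Y, hYn, hY⟩ := exists_diagonal b (fun i => min (α i) c) hc.le fun i => by
    rw [abs_of_nonneg (le_min (hα i) hc.le)]
    exact min_le_right _ _
  refine ⟨X, Y, ?_, ?_, hYn⟩
  · ext x
    refine ext_hilbertBasis b fun i => ?_
    rw [_root_.add_apply, inner_add_right, h, hX, hY, ← add_mul, ← Complex.ofReal_add]
    congr 2
    rcases le_total (α i) c with h | h
    · rw [max_eq_right (sub_nonpos.2 h), min_eq_left h, zero_add]
    · rw [max_eq_left (sub_nonneg.2 h), min_eq_right h, sub_add_cancel]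
  · rw [traceNorm_of_isPositive b (isPositive_of_diagonal b (fun i => le_max_right _ _) hX)]
    refine tsum_congr fun i => ?_
    rw [re_inner_eigenbasis b (apply_eq_smul_of_diagonal b hX), ENNReal.ofReal_max,
      ENNReal.ofReal_zero, max_eq_left zero_le]

/-- A diagonalization of a density operator. -/
theorem IsDensityOperator.exists_diagonalization.{u} {H : Type u} [NormedAddCommGroup H]
    [InnerProductSpace ℂ H] [CompleteSpace H] {A : H →L[ℂ] H} (hA : IsDensityOperator A) :
    ∃ (κ : Type u) (b : HilbertBasis κ ℂ H) (α : κ → ℝ),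
      (∀ i x, ⟪b i, A x⟫_ℂ = α i * ⟪b i, x⟫_ℂ) ∧ (∀ i, 0 ≤ α i) ∧
        ∑' i, ENNReal.ofReal (α i) = 1 := by
  obtain ⟨κ, b, α, h⟩ := exists_eigenbasis (isCompactOperator_of_isDensityOperator hA)
    hA.1.isSymmetric
  refine ⟨κ, b, α, inner_apply_of_eigenbasis b hA.1.isSymmetric h, fun i => ?_, ?_⟩
  · rw [← re_inner_eigenbasis b h i]
    exact (Complex.nonneg_iff.1 (hA.1.inner_nonneg_right _)).1
  · rw [← ((isDensityOperator_iff b).1 hA).2]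
    simp only [re_inner_eigenbasis b h]

/-! ### Contractions of the trace class. -/

theorem operatorEntropy_le_of_contraction [TopologicalSpace.SeparableSpace H]
    (T : traceClass H →ₗ[ℝ] traceClass H)
    (h1 : ∀ A, traceNorm (T A : H →L[ℂ] H) ≤ traceNorm (A : H →L[ℂ] H))
    (hop : ∀ A, ‖(T A : H →L[ℂ] H)‖ ≤ ‖(A : H →L[ℂ] H)‖)
    {ω : traceClass H} (hω : IsDensityOperator (ω : H →L[ℂ] H))
    (hTω : IsDensityOperator (T ω : H →L[ℂ] H)) :
    operatorEntropy (ω : H →L[ℂ] H) ≤ operatorEntropy (T ω : H →L[ℂ] H) := by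
  obtain ⟨κ, b, α, hb, hα, hα1⟩ := hω.exists_diagonalization
  obtain ⟨κ', e, β, he, hβ, hβ1⟩ := hTω.exists_diagonalization
  have := countable_of_hilbertBasis b
  have := countable_of_hilbertBasis e
  rw [operatorEntropy_eq_tsum b hb hα (by simp [hα1]),
    operatorEntropy_eq_tsum e he hβ (by simp [hβ1])]
  refine tsum_negMulLog_le hα hβ hα1 hβ1 fun c hc => ?_
  obtain ⟨X, Y, hXY, hX, hY⟩ := exists_truncation b hb hα (le_one_of_tsum_eq_one hα1) hc
  -- `T` acts only on trace class operators, so `X` has to be one; then `Y = ω - X` is one as well.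
  have hXmem : X ∈ traceClass H := by
    change traceNorm X ≠ ∞
    rw [hX]
    refine ne_top_of_le_ne_top (b := 1) (by simp) (hα1 ▸ ENNReal.tsum_le_tsum fun i => ?_)
    exact ENNReal.ofReal_le_ofReal (by linarith)
  let X' : traceClass H := ⟨X, hXmem⟩
  have hY' : ((ω - X' : traceClass H) : H →L[ℂ] H) = Y := by
    rw [Submodule.coe_sub, hXY]
    exact add_sub_cancel_left _ _
  have hT : (T ω : H →L[ℂ] H) = (T X' : H →L[ℂ] H) + (T (ω - X') : H →L[ℂ] H) := by
    rw [← Submodule.coe_add, ← map_add, add_sub_cancel]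
  have hTY : ‖(T (ω - X') : H →L[ℂ] H)‖ ≤ c := (hop _).trans (hY' ▸ hY)
  have key := tsum_ofReal_inner_sub_le_traceNorm e (T X') _ hTY
  rw [← hT] at key
  -- In its own eigenbasis, the diagonal entries of `T ω` are its eigenvalues `β`.
  simp only [re_inner_eigenbasis e (apply_eq_smul_of_diagonal e he)] at key
  exact key.trans ((h1 X').trans hX.le)

/-! ### Erasing the off-diagonal entries. -/

lemma IsOffDiagonalErasure.inner_apply {ι : Type*} {b : HilbertBasis ι ℂ H} {A D : H →L[ℂ] H}
    (hA : A.IsPositive) (hD : IsOffDiagonalErasure b A D) (i : ι) (x : H) :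
    ⟪b i, D x⟫_ℂ = (⟪b i, A (b i)⟫_ℂ).re * ⟪b i, x⟫_ℂ := by
  -- Passing to the adjoint extends the information from basis vectors to every `x`: the matrix
  -- entries determine the vector `D* bᵢ`, and `⟨bᵢ, D x⟩ = ⟨D* bᵢ, x⟩`.
  have h : ContinuousLinearMap.adjoint D (b i) = ((⟪b i, A (b i)⟫_ℂ).re : ℂ) • b i := by
    classical
    refine ext_hilbertBasis b fun j => ?_
    rw [ContinuousLinearMap.adjoint_inner_right, inner_smul_right, ← inner_conj_symm,
      orthonormal_iff_ite.1 b.orthonormal]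
    split_ifs with hij
    · rw [hij, hD.1, inner_eq_ofReal_re hA, Complex.conj_ofReal, Complex.ofReal_re, mul_one]
    · rw [hD.2 i j (Ne.symm hij), map_zero, mul_zero]
  rw [← ContinuousLinearMap.adjoint_inner_left, h, inner_smul_left, Complex.conj_ofReal]

theorem existsUnique_isOffDiagonalErasure {ι : Type*} (b : HilbertBasis ι ℂ H) {A : H →L[ℂ] H}
    (hA : A.IsPositive) : ∃! D : H →L[ℂ] H, IsOffDiagonalErasure b A D := by
  obtain ⟨D, -, hD⟩ := exists_diagonal b (fun i => (⟪b i, A (b i)⟫_ℂ).re) (norm_nonneg A)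
    fun i => by
      refine (Complex.abs_re_le_norm _).trans ((norm_inner_le_norm _ _).trans ?_)
      rw [b.orthonormal.1, one_mul]
      have := A.le_opNorm (b i)
      rwa [b.orthonormal.1, mul_one] at this
  refine ⟨D, ⟨fun i => ?_, fun i j hij => ?_⟩, fun D' hD' => ?_⟩
  · rw [hD, inner_self_eq_norm_sq_to_K, b.orthonormal.1, inner_eq_ofReal_re hA]
    simp
  · rw [hD, b.orthonormal.2 hij, mul_zero]
  · ext x
    refine ext_hilbertBasis b fun i => ?_
    rw [hD, hD'.inner_apply hA]

lemma IsOffDiagonalErasure.isDensityOperator {ι : Type*} {b : HilbertBasis ι ℂ H}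
    {A D : H →L[ℂ] H} (hA : IsDensityOperator A) (hD : IsOffDiagonalErasure b A D) :
    IsDensityOperator D := by
  refine (isDensityOperator_iff b).2 ⟨isPositive_of_diagonal b (fun i => ?_)
    (hD.inner_apply hA.1), ?_⟩
  · exact (Complex.nonneg_iff.1 (hA.1.inner_nonneg_right _)).1
  · simp only [hD.1]
    exact ((isDensityOperator_iff b).1 hA).2

theorem IsOffDiagonalErasure.operatorEntropy_le [TopologicalSpace.SeparableSpace H] {ι : Type*}
    {b : HilbertBasis ι ℂ H} {A D : H →L[ℂ] H} (hA : IsDensityOperator A)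
    (hD : IsOffDiagonalErasure b A D) : operatorEntropy A ≤ operatorEntropy D := by
  obtain ⟨κ, e, α, he, hα, hα1⟩ := hA.exists_diagonalization
  have := countable_of_hilbertBasis b
  have := countable_of_hilbertBasis e
  have hβ : ∀ i, 0 ≤ (⟪b i, A (b i)⟫_ℂ).re := fun i =>
    (Complex.nonneg_iff.1 (hA.1.inner_nonneg_right _)).1
  have hβ1 := ((isDensityOperator_iff b).1 hA).2
  rw [operatorEntropy_eq_tsum e he hα (by simp [hα1]),
    operatorEntropy_eq_tsum b (hD.inner_apply hA.1) hβ (by simp [hβ1])]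
  refine tsum_negMulLog_le hα hβ hα1 hβ1 fun c hc => ?_
  obtain ⟨X, Y, hXY, hX, hY⟩ := exists_truncation e he hα (le_one_of_tsum_eq_one hα1) hc
  -- The eigenvalues of `D` are the diagonal entries of `A = X + Y` in the basis `b`.
  rw [← hX, hXY]
  exact tsum_ofReal_inner_sub_le_traceNorm b X Y hY

end Operators

end EntropyNote

open EntropyNote in
theorem mainTheorem3
    (𝕜 : Type*) [RCLike 𝕜]
    (H : Type*) [NormedAddCommGroup H] [InnerProductSpace ℂ H] [CompleteSpace H]
    [TopologicalSpace.SeparableSpace H] :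
    -- sequences
    (∀ T : ell1 𝕜 →ₗ[ℝ] ell1 𝕜,
      (∀ x, ‖T x‖ ≤ ‖x‖) →
      (∀ x, supNorm (T x) ≤ supNorm x) →
      ∀ ω ∈ probabilitySequences 𝕜, T ω ∈ probabilitySequences 𝕜 →
        seqEntropy (fun n => RCLike.re (ω n)) ≤ seqEntropy (fun n => RCLike.re (T ω n))) ∧
    -- operators
    (∀ T : traceClass H →ₗ[ℝ] traceClass H,
      (∀ A, traceNorm (T A : H →L[ℂ] H) ≤ traceNorm (A : H →L[ℂ] H)) →
      (∀ A, ‖(T A : H →L[ℂ] H)‖ ≤ ‖(A : H →L[ℂ] H)‖) →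
      ∀ ω : traceClass H, IsDensityOperator (ω : H →L[ℂ] H) →
        IsDensityOperator (T ω : H →L[ℂ] H) →
        operatorEntropy (ω : H →L[ℂ] H) ≤ operatorEntropy (T ω : H →L[ℂ] H)) ∧
    -- erasing the off-diagonal entries of a density operator
    (∀ (ι : Type*) (b : HilbertBasis ι ℂ H) (ω : H →L[ℂ] H), IsDensityOperator ω →
      (∃! D : H →L[ℂ] H, IsOffDiagonalErasure b ω D) ∧
      ∀ D : H →L[ℂ] H, IsOffDiagonalErasure b ω D →
        IsDensityOperator D ∧ operatorEntropy ω ≤ operatorEntropy D) := by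
  refine ⟨fun T h1 hsup ω hω hTω => seqEntropy_le_of_contraction T h1 hsup hω hTω,
    fun T h1 hop ω hω hTω => operatorEntropy_le_of_contraction T h1 hop hω hTω,
    fun ι b ω hω => ⟨existsUnique_isOffDiagonalErasure b hω.1, fun D hD =>
      ⟨hD.isDensityOperator hω, hD.operatorEntropy_le hω⟩⟩⟩
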